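/- **Setting.** Let $\Pi$ be a decision space and $\mathcal O$ an observation space (measurable spaces, with $\Pi$ countable or the $\sigma$-algebra of $\mathcal O$ countably generated, as for a separable metric space). Let $\mathcal M$ be a finite model class. Each $M\in\mathcal M$ is a Markov kernel $\pi\mapsto M(\pi)$ from $\Pi$ to $\mathcal O$, with a measurable mean reward function $f_M:\Pi\to\mathbb R$ that attains its maximum at a decision $\pi_M$. Let $M^*\in\mathcal M$ be the true model, $\eta>0$ and $T\in\mathbb N$. An algorithm is a sequence of Markov kernels which give, in round $t=1,\dots,T$, a law $p_t$ of the next decision as a function of the history $h_{t-1}=(\pi_s,o_s)_{s<t}$. Then $\pi_t\sim p_t$ is drawn, and $o_t\sim M^*(\pi_t)$ is observed. All expectations and "almost surely" refer to the resulting law of the history, and each $f_M(\pi_t)$ is assumed to have a finite expectation. The regret is $$\mathrm{Reg}_T=\sup_{\pi\in\Pi}\mathbb E\Big[\sum_{t=1}^T f_{M^*}(\pi)-\sum_{t=1}^T f_{M^*}(\pi_t)\Big].$$ **MAIR.** Let $\Delta(\mathcal M)$ be the simplex of probability vectors on $\mathcal M$ and $\mathrm{int}\,\Delta(\mathcal M)$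 the set of those with positive entries. For $\mu\in\Delta(\mathcal M)$ let $\mu(\cdot\mid\pi,o)$ be the Bayesian posterior of the model, $\mu(M\mid\pi,o)\propto\mu(M)\,m_M(o\mid\pi)$, where $m_M(\cdot\mid\pi)$ is the density of $M(\pi)$ with respect to $\sum_{M'}M'(\pi)$. For $\rho\in\mathrm{int}\,\Delta(\mathcal M)$ and a probability measure $p$ on $\Pi$ put $$\mathrm{MAIR}_{\rho,\eta}(p,\mu)=\mathbb E_{M\sim\mu,\ \pi\sim p,\ o\sim M(\pi)}\Big[f_M(\pi_M)-f_M(\pi)-\tfrac1\eta\,\mathrm{KL}\big(\mu(\cdot\mid\pi,o),\rho\big)\Big],$$ where $M$ and $\pi$ are independent. Let $\partial\,\mathrm{MAIR}_{\rho,\eta}(p,\mu)/\partial\mu$ be the derivative of $\mu\mapsto\mathrm{MAIR}_{\rho,\eta}(p,\mu)$ within the simplex $\Delta(\mathcal M)$. It is determined on directions tangent to the simplex. Let $\mathbb 1(M^*)\in\Delta(\mathcal M)$ be the vector with $M^*$-coordinate $1$ and all other coordinates $0$. **Theorem.** Let the algorithm be arbitrary, and let $\mu_1,\dots,\mu_T$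 be an arbitrary sequence of beliefs, $\mu_t\in\Delta(\mathcal M)$ being a function of the history $h_{t-1}$. Let $\rho_1$ be the uniform distribution on $\mathcal M$ and $\rho_{t+1}=\mu_t(\cdot\mid\pi_t,o_t)$ for $t\ge1$. Assume that $\mu_t,\rho_t\in\mathrm{int}\,\Delta(\mathcal M)$ almost surely for $t=1,\dots,T$. Then, almost surely, for every $t\le T$ the function $\mu\mapsto\mathrm{MAIR}_{\rho_t,\eta}(p_t,\mu)$ is differentiable at $\mu_t$ within $\Delta(\mathcal M)$. Moreover, if the random variable inside the expectation on the right-hand side below is integrable, then $$\mathrm{Reg}_T\le\frac{\log|\mathcal M|}{\eta}+\mathbb E\Big[\sum_{t=1}^T\Big(\mathrm{MAIR}_{\rho_t,\eta}(p_t,\mu_t)+\Big\langle\frac{\partial\,\mathrm{MAIR}_{\rho_t,\eta}(p_t,\mu)}{\partial\mu}\Big|_{\mu=\mu_t},\ \mathbb 1(M^*)-\mu_t\Big\rangle\Big)\Big].$$ -/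

import Mathlib

open MeasureTheory ProbabilityTheory

noncomputable section

namespace DMSO

/-! Decision making with structured observations, in a stochastic environment, with a finite
model class. `D` is the decision space, `O` the observation space, and the finite type `𝓜` indexes
the model class: `model M` is the Markov kernel sending a decision `a` to the law `M(a)` of the
observation. `f M` is the mean reward function of `M`, and `opt M` is the decision `π_M`.
A history of `t` completed rounds is an element of `Fin t → D × O`; the entry `i` holds the
decision and the observation of the `(i+1)`-st round. An algorithm is a sequence of Markov kernels
`alg t`, giving the law of the next decision after a history of `t` rounds. -/

variable {D O 𝓜 : Type*} [MeasurableSpace D] [MeasurableSpace O]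

/-- The law of the history of the first `t` rounds when, in each round, the decision is drawn from
the algorithm and then the observation is drawn from the true model `trueModel`. -/
def historyLaw (trueModel : Kernel D O) (alg : (t : ℕ) → Kernel (Fin t → D × O) D) :
    (t : ℕ) → Measure (Fin t → D × O)
  | 0 => Measure.dirac Fin.elim0
  | t + 1 =>
    (historyLaw trueModel alg t ⊗ₘ (alg t ⊗ₖ Kernel.prodMkLeft (Fin t → D × O) trueModel)).map
      (fun x => (Fin.snoc x.1 x.2 : Fin (t + 1) → D × O))

/-- The part of a history of `T` rounds that precedes the round with (zero-based) index `t`. -/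
def past {T : ℕ} (h : Fin T → D × O) (t : Fin T) : Fin t → D × O :=
  fun i => h (Fin.castLE t.isLt.le i)

/-- The frequentist regret after `T` rounds against the single best decision, in the environment
that uses the true model (with mean reward function `g`) in every round. -/
def regret (trueModel : Kernel D O) (g : D → ℝ) (alg : (t : ℕ) → Kernel (Fin t → D × O) D)
    (T : ℕ) : ℝ :=
  ⨆ a : D, ∫ h, ((∑ _t : Fin T, g a) - ∑ t : Fin T, g (h t).1) ∂historyLaw trueModel alg T

variable [Fintype 𝓜]

/-- The likelihood of the model `M` at a pair `(a, o)`: the (jointly measurable) density at `o` of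
the law `M(a)` with respect to the sum of the laws `M'(a)` over all models `M'`. -/
def likelihood [MeasurableSpace.CountableOrCountablyGenerated D O] (model : 𝓜 → Kernel D O)
    (M : 𝓜) (x : D × O) : ℝ :=
  (Kernel.rnDeriv (model M) (∑ M', model M') x.1 x.2).toReal

/-- The Bayesian posterior `μ(· | a, o)` on the models, by Bayes' rule, for the prior belief `μ`
and the pair `x = (a, o)`. -/
def posterior [MeasurableSpace.CountableOrCountablyGenerated D O] (model : 𝓜 → Kernel D O)
    (μ : 𝓜 → ℝ) (x : D × O) (M : 𝓜) : ℝ :=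
  μ M * likelihood model M x / ∑ M', μ M' * likelihood model M' x

/-- The Kullback-Leibler divergence of two probability vectors, the second one having positive
entries. -/
def finiteKL (u v : 𝓜 → ℝ) : ℝ := ∑ M, u M * Real.log (u M / v M)

/-- The model-index algorithmic information ratio `MAIR_{ρ,η}(p, μ)`: the expectation of
`f_M(π_M) - f_M(π) - KL(μ(· | π, o), ρ) / η` for `M ∼ μ`, an independent decision `π ∼ p`,
and an observation `o ∼ M(π)`. -/
def mair [MeasurableSpace.CountableOrCountablyGenerated D O] (model : 𝓜 → Kernel D O)
    (f : 𝓜 → D → ℝ) (opt : 𝓜 → D) (η : ℝ) (ρ : 𝓜 → ℝ) (p : Measure D) (μ : 𝓜 → ℝ) : ℝ :=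
  ∑ M, μ M * ∫ x, (f M (opt M) - f M x.1 - 1 / η * finiteKL (posterior model μ x) ρ)
    ∂(p ⊗ₘ model M)

/-- The pairing `⟨∂MAIR_{ρ,η}(p, ·)/∂μ at μ, 1(M₀) - μ⟩`. The derivative is taken within the
simplex of beliefs, the domain of MAIR; it is determined on the directions tangent to the simplex,
and `1(M₀) - μ` is such a direction. -/
def mairGradPairing [DecidableEq 𝓜] [MeasurableSpace.CountableOrCountablyGenerated D O]
    (model : 𝓜 → Kernel D O) (f : 𝓜 → D → ℝ) (opt : 𝓜 → D) (η : ℝ) (ρ : 𝓜 → ℝ)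
    (p : Measure D) (μ : 𝓜 → ℝ) (M₀ : 𝓜) : ℝ :=
  fderivWithin ℝ (mair model f opt η ρ p) (stdSimplex ℝ 𝓜) μ (Pi.single M₀ 1 - μ)

/-- The reference distributions generated by the beliefs: uniform before the first round, and
then the posterior of the belief of the last round given its decision and its observation.
Here `μ t h` is the belief of the round that follows the history `h` of `t` rounds. -/
def reference [MeasurableSpace.CountableOrCountablyGenerated D O] (model : 𝓜 → Kernel D O)
    (μ : (t : ℕ) → (Fin t → D × O) → 𝓜 → ℝ) : (t : ℕ) → (Fin t → D × O) → 𝓜 → ℝ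
  | 0, _ => fun _ => 1 / (Fintype.card 𝓜 : ℝ)
  | t + 1, h => posterior model (μ t (Fin.init h)) (h (Fin.last t))

end DMSO

end

/-! On vectors with positive entries, `mair` is homogeneous of degree one in `μ`, because Bayes'
rule does not see the scale of the prior. Euler's identity therefore says that `mair` is the pairing
of its gradient with `μ`. Hence MAIR plus its pairing with `1(M*) - μ` is the single partial
derivative in the coordinate `M*` (`mair_eq_sum_mairPartial`, `mair_add_mairGradPairing`).

That partial derivative is an expectation under the true model: `E[f(π_M*) - f(π) - (log μ(M* | π,
o) - log ρ(M*)) / η]` with `π ∼ p`, `o ∼ M*(π)` and `f = f_M*` (`mairPartial_eq`). Since the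
posterior of one round is the reference of the next, the logarithms telescope: accumulated regret
minus `log ρ(M*) / η` has exactly this conditional drift (`potential_step`). It starts at `log |𝓜| /
η`, and the final log-loss is nonnegative, which gives the bound (`integral_le_of_potential`).

The analytic work is the derivative of `mair`. All models are written as densities with respect to
their sum, so the likelihoods lie in `[0, 1]` and add up to one. Near a positive belief the marginal
likelihood then stays in a compact subset of `(0, ∞)`, and differentiation under the integral is
dominated. -/

noncomputable section

namespace DMSO

/-! ### Densities of the models with respect to their sum -/

section Likelihood

variable {D O 𝓜 : Type*} [MeasurableSpace D] [MeasurableSpace O] [Fintype 𝓜]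
  [MeasurableSpace.CountableOrCountablyGenerated D O] (model : 𝓜 → Kernel D O)

instance isFiniteKernel_finset_sum (s : Finset 𝓜) [∀ M, IsFiniteKernel (model M)] :
    IsFiniteKernel (∑ M ∈ s, model M) := by
  classical
  induction s using Finset.induction_on with
  | empty => rw [Finset.sum_empty]; infer_instance
  | insert a s ha ih => rw [Finset.sum_insert ha]; infer_instance

lemma measurable_likelihood (M : 𝓜) : Measurable (likelihood model M) :=
  (Kernel.measurable_rnDeriv (model M) (∑ M', model M')).ennreal_toReal

lemma likelihood_nonneg (M : 𝓜) (x : D × O) : 0 ≤ likelihood model M x :=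
  ENNReal.toReal_nonneg

lemma likelihood_le_one {x : D × O} (hx : ∑ M, likelihood model M x = 1) (M : 𝓜) :
    likelihood model M x ≤ 1 :=
  hx ▸ Finset.single_le_sum (fun M' _ => likelihood_nonneg model M' x) (Finset.mem_univ M)

/-- The reference measure `p ⊗ ∑ M, M` on pairs of a decision and an observation. -/
def dominating (p : Measure D) : Measure (D × O) := p ⊗ₘ (∑ M, model M)

variable [∀ M, IsMarkovKernel (model M)] (p : Measure D) [IsProbabilityMeasure p]

instance : IsFiniteMeasure (dominating model p) := by
  unfold dominating; infer_instance

lemma ofReal_likelihood_ae (M : 𝓜) (a : D) :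
    ∀ᵐ o ∂(∑ M', model M') a, ENNReal.ofReal (likelihood model M (a, o)) =
      Kernel.rnDeriv (model M) (∑ M', model M') a o := by
  filter_upwards [Kernel.rnDeriv_ne_top (model M) (∑ M', model M')] with o ho
    using ENNReal.ofReal_toReal ho

omit [MeasurableSpace.CountableOrCountablyGenerated D O] [∀ M, IsMarkovKernel (model M)] in
lemma model_absolutelyContinuous_sum (M : 𝓜) (a : D) :
    model M a ≪ (∑ M', model M') a := by
  refine Measure.absolutelyContinuous_of_le ?_
  rw [_root_.sum_apply]
  exact Finset.single_le_sum (f := fun M' => model M' a) (fun _ _ => Measure.zero_le _)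
    (Finset.mem_univ M)

/-- Absolute continuity holds in every fibre, so Radon-Nikodym applies for each decision. Integrals
under different models become integrals over one finite measure and can be added. -/
lemma compProd_model_eq_withDensity (M : 𝓜) :
    p ⊗ₘ model M =
      (dominating model p).withDensity (fun x => ENNReal.ofReal (likelihood model M x)) := by
  have hm : Measurable fun x => ENNReal.ofReal (likelihood model M x) :=
    (measurable_likelihood model M).ennreal_ofReal
  ext s hs
  rw [withDensity_apply _ hs, ← lintegral_indicator hs, dominating,
    Measure.lintegral_compProd (hm.indicator hs), Measure.compProd_apply hs]
  refine lintegral_congr fun a => ?_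
  have hsa : MeasurableSet (Prod.mk a ⁻¹' s) := measurable_prodMk_left hs
  rw [← Kernel.setLIntegral_rnDeriv (model_absolutelyContinuous_sum model M a) hsa,
    ← lintegral_indicator hsa]
  refine lintegral_congr_ae ?_
  filter_upwards [ofReal_likelihood_ae model M a] with o ho
  by_cases h : (a, o) ∈ s
  · have h' : o ∈ Prod.mk a ⁻¹' s := h
    rw [Set.indicator_of_mem h, Set.indicator_of_mem h', ho]
  · have h' : o ∉ Prod.mk a ⁻¹' s := h
    rw [Set.indicator_of_notMem h, Set.indicator_of_notMem h']

omit [MeasurableSpace.CountableOrCountablyGenerated D O] in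
lemma compProd_sum_right_apply (s : Set (D × O)) (hs : MeasurableSet s) :
    dominating model p s = ∑ M, (p ⊗ₘ model M) s := by
  rw [dominating, Measure.compProd_apply hs]
  simp_rw [Measure.compProd_apply hs]
  rw [← lintegral_finsetSum _ fun M _ => Kernel.measurable_kernel_prodMk_left hs]
  refine lintegral_congr fun a => ?_
  rw [_root_.sum_apply, Measure.finsetSum_apply]

/-- The sum of the densities is the density of `dominating model p` with respect to itself. This
identity is the source of the bounds on likelihoods and evidence below. -/
lemma sum_likelihood_ae :
    ∀ᵐ x ∂dominating model p, ∑ M, likelihood model M x = 1 := by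
  have hm : ∀ M, Measurable fun x => ENNReal.ofReal (likelihood model M x) :=
    fun M => (measurable_likelihood model M).ennreal_ofReal
  have key : (fun x => ∑ M, ENNReal.ofReal (likelihood model M x))
      =ᵐ[dominating model p] fun _ => 1 := by
    rw [← withDensity_eq_iff_of_sigmaFinite (Finset.measurable_sum _ fun M _ => hm M).aemeasurable
      aemeasurable_const]
    ext s hs
    rw [withDensity_apply _ hs, lintegral_finsetSum _ fun M _ => hm M,
      withDensity_apply _ hs, setLIntegral_one, compProd_sum_right_apply model p s hs]
    refine Finset.sum_congr rfl fun M _ => ?_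
    rw [compProd_model_eq_withDensity model p M, withDensity_apply _ hs]
  filter_upwards [key] with x hx
  rw [← ENNReal.ofReal_sum_of_nonneg fun M _ => likelihood_nonneg model M x] at hx
  exact ENNReal.ofReal_eq_one.1 hx

lemma integral_compProd_model (M : 𝓜) (g : D × O → ℝ) :
    ∫ x, g x ∂(p ⊗ₘ model M) = ∫ x, likelihood model M x * g x ∂dominating model p := by
  rw [compProd_model_eq_withDensity model p M, integral_withDensity_eq_integral_toReal_smul
    (measurable_likelihood model M).ennreal_ofReal (by simp)]
  simp [ENNReal.toReal_ofReal (likelihood_nonneg model M _)]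

lemma integrable_compProd_model_iff (M : 𝓜) (g : D × O → ℝ) :
    Integrable g (p ⊗ₘ model M) ↔
      Integrable (fun x => likelihood model M x * g x) (dominating model p) := by
  rw [compProd_model_eq_withDensity model p M, integrable_withDensity_iff_integrable_smul'
    (measurable_likelihood model M).ennreal_ofReal (by simp)]
  simp [ENNReal.toReal_ofReal (likelihood_nonneg model M _)]

lemma integrable_of_bounded_of_sum_likelihood {g : D × O → ℝ} (hg : Measurable g) (C : ℝ)
    (hC : ∀ x, ∑ M, likelihood model M x = 1 → |g x| ≤ C) :
    Integrable g (dominating model p) :=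
  Integrable.of_bound hg.aestronglyMeasurable C <| by
    filter_upwards [sum_likelihood_ae model p] with x hx using hC x hx

lemma abs_mul_log_le_one {u : ℝ} (h0 : 0 ≤ u) (h1 : u ≤ 1) : |u * Real.log u| ≤ 1 := by
  rcases h0.eq_or_lt with rfl | h
  · simp
  · rw [mul_comm]; exact (Real.abs_log_mul_self_lt u h h1).le

lemma integrable_likelihood_mul_log (M : 𝓜) :
    Integrable (fun x => likelihood model M x * Real.log (likelihood model M x))
      (dominating model p) :=
  integrable_of_bounded_of_sum_likelihood model p
    ((measurable_likelihood model M).mul (measurable_likelihood model M).log) 1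
    fun x hx => abs_mul_log_le_one (likelihood_nonneg model M x) (likelihood_le_one model hx M)

lemma integrable_likelihood (M : 𝓜) :
    Integrable (likelihood model M) (dominating model p) :=
  integrable_of_bounded_of_sum_likelihood model p (measurable_likelihood model M) 1
    fun x hx => by
      rw [abs_of_nonneg (likelihood_nonneg model M x)]; exact likelihood_le_one model hx M

lemma integral_likelihood (M : 𝓜) :
    ∫ x, likelihood model M x ∂dominating model p = 1 := by
  have := integral_compProd_model model p M fun _ => 1
  simpa using this.symm

end Likelihood

/-! ### Marginal likelihood, posterior and the KL term -/

section Evidence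

variable {D O 𝓜 : Type*} [MeasurableSpace D] [MeasurableSpace O] [Fintype 𝓜]
  [MeasurableSpace.CountableOrCountablyGenerated D O] (model : 𝓜 → Kernel D O)

/-- The marginal likelihood of a pair of a decision and an observation under the belief `μ`. -/
def evidence (μ : 𝓜 → ℝ) (x : D × O) : ℝ := ∑ M, μ M * likelihood model M x

lemma measurable_evidence (μ : 𝓜 → ℝ) : Measurable (evidence model μ) :=
  Finset.measurable_sum _ fun M _ => (measurable_likelihood model M).const_mul _

lemma le_evidence {μ : 𝓜 → ℝ} {c : ℝ} (hc : ∀ M, c ≤ μ M) {x : D × O}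
    (hx : ∑ M, likelihood model M x = 1) : c ≤ evidence model μ x := by
  calc c = ∑ M, c * likelihood model M x := by rw [← Finset.mul_sum, hx, mul_one]
    _ ≤ _ := Finset.sum_le_sum fun M _ =>
      mul_le_mul_of_nonneg_right (hc M) (likelihood_nonneg model M x)

lemma evidence_le {μ : 𝓜 → ℝ} {C : ℝ} (hC : ∀ M, μ M ≤ C) {x : D × O}
    (hx : ∑ M, likelihood model M x = 1) : evidence model μ x ≤ C := by
  calc evidence model μ x ≤ ∑ M, C * likelihood model M x := Finset.sum_le_sum fun M _ =>
      mul_le_mul_of_nonneg_right (hC M) (likelihood_nonneg model M x)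
    _ = C := by rw [← Finset.mul_sum, hx, mul_one]

lemma exists_pos_bounds [Nonempty 𝓜] {μ : 𝓜 → ℝ} (hμ : ∀ M, 0 < μ M) :
    ∃ c C : ℝ, 0 < c ∧ (∀ M, c ≤ μ M) ∧ ∀ M, μ M ≤ C := by
  obtain ⟨M₀, h₀⟩ := Finite.exists_min μ
  obtain ⟨M₁, h₁⟩ := Finite.exists_max μ
  exact ⟨μ M₀, μ M₁, hμ M₀, h₀, h₁⟩

lemma posterior_nonneg {μ : 𝓜 → ℝ} (hμ : ∀ M, 0 ≤ μ M) (x : D × O) (M : 𝓜) :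
    0 ≤ posterior model μ x M :=
  div_nonneg (mul_nonneg (hμ M) (likelihood_nonneg model M x))
    (Finset.sum_nonneg fun M' _ => mul_nonneg (hμ M') (likelihood_nonneg model M' x))

lemma posterior_le_one {μ : 𝓜 → ℝ} (hμ : ∀ M, 0 ≤ μ M) (x : D × O) (M : 𝓜) :
    posterior model μ x M ≤ 1 :=
  div_le_one_of_le₀
    (Finset.single_le_sum (f := fun M' => μ M' * likelihood model M' x)
      (fun M' _ => mul_nonneg (hμ M') (likelihood_nonneg model M' x)) (Finset.mem_univ M))
    (Finset.sum_nonneg fun M' _ => mul_nonneg (hμ M') (likelihood_nonneg model M' x))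

lemma measurable_posterior (μ : 𝓜 → ℝ) (M : 𝓜) :
    Measurable fun x => posterior model μ x M :=
  ((measurable_likelihood model M).const_mul _).div (measurable_evidence model μ)

lemma measurable_finiteKL_posterior (μ ρ : 𝓜 → ℝ) :
    Measurable fun x => finiteKL (posterior model μ x) ρ :=
  Finset.measurable_sum _ fun M _ => (measurable_posterior model μ M).mul
    ((measurable_posterior model μ M).div_const _).log

/-- Valid at every point: where the evidence vanishes, division by zero makes the posterior the zero
vector, whose entries still lie in `[0, 1]`. -/
lemma abs_finiteKL_posterior_le {μ ρ : 𝓜 → ℝ} (hμ : ∀ M, 0 ≤ μ M) (hρ : ∀ M, 0 < ρ M)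
    (x : D × O) :
    |finiteKL (posterior model μ x) ρ| ≤ ∑ M, (1 + |Real.log (ρ M)|) := by
  refine (Finset.abs_sum_le_sum_abs _ _).trans (Finset.sum_le_sum fun M _ => ?_)
  have h0 := posterior_nonneg model hμ x M
  have h1 := posterior_le_one model hμ x M
  generalize posterior model μ x M = u at h0 h1
  rcases h0.eq_or_lt with rfl | h
  · simp; positivity
  · rw [Real.log_div h.ne' (hρ M).ne', mul_sub]
    refine (abs_sub _ _).trans (add_le_add (abs_mul_log_le_one h0 h1) ?_)
    rw [abs_mul, abs_of_pos h]
    exact mul_le_of_le_one_left (abs_nonneg _) h1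

/-- Multiplying by the evidence clears the denominator of the posterior. What remains couples the
coordinates of `μ` only through the entropy term `negMulLog` of the evidence, so the derivative can
be taken term by term. -/
lemma evidence_mul_finiteKL_posterior [Nonempty 𝓜] {μ ρ : 𝓜 → ℝ} (hμ : ∀ M, 0 < μ M)
    (hρ : ∀ M, 0 < ρ M) {x : D × O} (hx : ∑ M, likelihood model M x = 1) :
    evidence model μ x * finiteKL (posterior model μ x) ρ =
      (∑ M, ((μ M * (Real.log (μ M) - Real.log (ρ M))) * likelihood model M x
        + μ M * (likelihood model M x * Real.log (likelihood model M x))))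
      + Real.negMulLog (evidence model μ x) := by
  obtain ⟨c, C, hc, hcμ, -⟩ := exists_pos_bounds hμ
  have hS : 0 < evidence model μ x := hc.trans_le (le_evidence model hcμ hx)
  have hterm : ∀ M, evidence model μ x *
      (posterior model μ x M * Real.log (posterior model μ x M / ρ M)) =
      ((μ M * (Real.log (μ M) - Real.log (ρ M))) * likelihood model M x
        + μ M * (likelihood model M x * Real.log (likelihood model M x)))
      - μ M * likelihood model M x * Real.log (evidence model μ x) := by
    intro M
    have hp : posterior model μ x M = μ M * likelihood model M x / evidence model μ x := rfl
    rw [← mul_assoc, hp, mul_div_cancel₀ _ hS.ne']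
    rcases (likelihood_nonneg model M x).eq_or_lt with h | h
    · simp [← h]
    · rw [Real.log_div (by have := hμ M; positivity) (hρ M).ne',
        Real.log_div (by have := hμ M; positivity) hS.ne', Real.log_mul (hμ M).ne' h.ne']
      ring
  rw [finiteKL, Finset.mul_sum, Finset.sum_congr rfl fun M _ => hterm M,
    Finset.sum_sub_distrib, ← Finset.sum_mul, Real.negMulLog]
  change _ - evidence model μ x * _ = _
  ring

end Evidence

/-! ### The derivative of MAIR -/

section Gradient

variable {D O 𝓜 : Type*} [MeasurableSpace D] [MeasurableSpace O] [Fintype 𝓜]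
  [MeasurableSpace.CountableOrCountablyGenerated D O] (model : 𝓜 → Kernel D O)
  [∀ M, IsMarkovKernel (model M)] (p : Measure D) [IsProbabilityMeasure p]

lemma integrable_likelihood_mul_log_evidence [Nonempty 𝓜] {μ : 𝓜 → ℝ} (hμ : ∀ M, 0 < μ M)
    (M : 𝓜) :
    Integrable (fun x => likelihood model M x * Real.log (evidence model μ x))
      (dominating model p) := by
  obtain ⟨c, C, hc, hcμ, hμC⟩ := exists_pos_bounds hμ
  refine integrable_of_bounded_of_sum_likelihood model p
    ((measurable_likelihood model M).mul (measurable_evidence model μ).log)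
    (max |Real.log c| |Real.log C|) fun x hx => ?_
  have h1 := le_evidence model hcμ hx
  have h2 := evidence_le model hμC hx
  rw [abs_mul, abs_of_nonneg (likelihood_nonneg model M x)]
  exact (mul_le_of_le_one_left (abs_nonneg _) (likelihood_le_one model hx M)).trans
    (abs_le_max_abs_abs (Real.log_le_log hc h1) (Real.log_le_log (hc.trans_le h1) h2))

omit [∀ M, IsMarkovKernel (model M)] in
lemma negMulLog_evidence (μ : 𝓜 → ℝ) (x : D × O) :
    Real.negMulLog (evidence model μ x) =
      ∑ M, -μ M * (likelihood model M x * Real.log (evidence model μ x)) := by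
  rw [Real.negMulLog]
  conv_lhs => enter [1, 1]; rw [evidence]
  rw [← Finset.sum_neg_distrib, Finset.sum_mul]
  exact Finset.sum_congr rfl fun M _ => by ring

lemma integrable_negMulLog_evidence [Nonempty 𝓜] {μ : 𝓜 → ℝ} (hμ : ∀ M, 0 < μ M) :
    Integrable (fun x => Real.negMulLog (evidence model μ x)) (dominating model p) := by
  simp_rw [negMulLog_evidence]
  exact integrable_finsetSum _ fun M _ =>
    (integrable_likelihood_mul_log_evidence model p hμ M).const_mul _

lemma integral_negMulLog_evidence [Nonempty 𝓜] {μ : 𝓜 → ℝ} (hμ : ∀ M, 0 < μ M) :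
    ∫ x, Real.negMulLog (evidence model μ x) ∂dominating model p =
      -∑ M, μ M * ∫ x, likelihood model M x * Real.log (evidence model μ x)
        ∂dominating model p := by
  simp_rw [negMulLog_evidence]
  rw [integral_finsetSum _ fun M _ =>
    (integrable_likelihood_mul_log_evidence model p hμ M).const_mul _, ← Finset.sum_neg_distrib]
  exact Finset.sum_congr rfl fun M _ => by rw [integral_const_mul, neg_mul]

omit [∀ M, IsMarkovKernel (model M)] in
lemma hasFDerivAt_evidence (μ : 𝓜 → ℝ) (x : D × O) :
    HasFDerivAt (fun μ => evidence model μ x)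
      (∑ M, likelihood model M x • (ContinuousLinearMap.proj M : (𝓜 → ℝ) →L[ℝ] ℝ)) μ :=
  HasFDerivAt.fun_sum fun M _ => by
    simpa using (hasFDerivAt_apply (𝕜 := ℝ) M μ).mul_const (likelihood model M x)

/-- The derivative of `μ ↦ negMulLog (evidence model μ x)`. -/
def entropyDeriv (μ : 𝓜 → ℝ) (x : D × O) : (𝓜 → ℝ) →L[ℝ] ℝ :=
  ∑ M, (-(likelihood model M x * Real.log (evidence model μ x)) - likelihood model M x)
    • (ContinuousLinearMap.proj M : (𝓜 → ℝ) →L[ℝ] ℝ)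

omit [∀ M, IsMarkovKernel (model M)] in
lemma hasFDerivAt_negMulLog_evidence {μ : 𝓜 → ℝ} {x : D × O} (h : evidence model μ x ≠ 0) :
    HasFDerivAt (fun μ => Real.negMulLog (evidence model μ x)) (entropyDeriv model μ x) μ := by
  refine ((Real.hasDerivAt_negMulLog h).comp_hasFDerivAt μ
    (hasFDerivAt_evidence model μ x)).congr_fderiv ?_
  rw [entropyDeriv, Finset.smul_sum]
  refine Finset.sum_congr rfl fun M _ => ?_
  rw [smul_smul]
  congr 1
  ring

omit [∀ M, IsMarkovKernel (model M)] in
-- The bound is uniform over the box `[c, C]` of beliefs, as the domination argument requires.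
lemma norm_entropyDeriv_le {μ : 𝓜 → ℝ} {c C : ℝ} (hc : 0 < c) (hcμ : ∀ M, c ≤ μ M)
    (hμC : ∀ M, μ M ≤ C) {x : D × O} (hx : ∑ M, likelihood model M x = 1) :
    ‖entropyDeriv model μ x‖ ≤ ∑ _M : 𝓜, (max |Real.log c| |Real.log C| + 1) := by
  have h1 := le_evidence model hcμ hx
  have h3 := abs_le_max_abs_abs (Real.log_le_log hc h1)
    (Real.log_le_log (hc.trans_le h1) (evidence_le model hμC hx))
  refine (norm_sum_le _ _).trans (Finset.sum_le_sum fun M _ => ?_)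
  have h4 : ‖(ContinuousLinearMap.proj M : (𝓜 → ℝ) →L[ℝ] ℝ)‖ ≤ 1 :=
    ContinuousLinearMap.opNorm_le_bound _ zero_le_one fun v => by
      simpa using norm_le_pi_norm v M
  have h5 := likelihood_nonneg model M x
  have h6 := likelihood_le_one model hx M
  rw [norm_smul, Real.norm_eq_abs]
  refine (mul_le_of_le_one_right (abs_nonneg _) h4).trans ((abs_sub _ _).trans ?_)
  rw [abs_neg, abs_mul, abs_of_nonneg h5]
  exact add_le_add ((mul_le_of_le_one_left (abs_nonneg _) h6).trans h3) h6

lemma integrable_entropyDeriv_coeff [Nonempty 𝓜] {μ : 𝓜 → ℝ} (hμ : ∀ M, 0 < μ M) (M : 𝓜) :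
    Integrable (fun x =>
      -(likelihood model M x * Real.log (evidence model μ x)) - likelihood model M x)
      (dominating model p) :=
  (integrable_likelihood_mul_log_evidence model p hμ M).neg.sub (integrable_likelihood model p M)

lemma aestronglyMeasurable_entropyDeriv [Nonempty 𝓜] {μ : 𝓜 → ℝ} (hμ : ∀ M, 0 < μ M) :
    AEStronglyMeasurable (fun x => entropyDeriv model μ x) (dominating model p) :=
  Finset.aestronglyMeasurable_fun_sum _ fun M _ =>
    ((integrable_entropyDeriv_coeff model p hμ M).smul_const
      (ContinuousLinearMap.proj M : (𝓜 → ℝ) →L[ℝ] ℝ)).aestronglyMeasurable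

lemma integral_entropyDeriv [Nonempty 𝓜] {μ : 𝓜 → ℝ} (hμ : ∀ M, 0 < μ M) :
    ∫ x, entropyDeriv model μ x ∂dominating model p =
      ∑ M, (-(∫ x, likelihood model M x * Real.log (evidence model μ x) ∂dominating model p) - 1)
        • (ContinuousLinearMap.proj M : (𝓜 → ℝ) →L[ℝ] ℝ) := by
  simp_rw [entropyDeriv]
  rw [integral_finsetSum _ fun M _ => (integrable_entropyDeriv_coeff model p hμ M).smul_const _]
  refine Finset.sum_congr rfl fun M _ => ?_
  rw [integral_smul_const, integral_sub
    (integrable_likelihood_mul_log_evidence model p hμ M).fun_neg (integrable_likelihood model p M),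
    integral_neg, integral_likelihood]

lemma hasFDerivAt_integral_negMulLog_evidence [Nonempty 𝓜] {μ : 𝓜 → ℝ} (hμ : ∀ M, 0 < μ M) :
    HasFDerivAt (fun μ => ∫ x, Real.negMulLog (evidence model μ x) ∂dominating model p)
      (∑ M, (-(∫ x, likelihood model M x * Real.log (evidence model μ x) ∂dominating model p) - 1)
        • (ContinuousLinearMap.proj M : (𝓜 → ℝ) →L[ℝ] ℝ)) μ := by
  obtain ⟨c, C, hc, hcμ, hμC⟩ := exists_pos_bounds hμ
  -- The lower side `c / 2` keeps the evidence away from zero, where its logarithm would be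
  -- unbounded.
  have hsμ : (Set.univ.pi fun _ : 𝓜 => Set.Ioo (c / 2) (C + 1)) ∈ nhds μ := by
    refine (isOpen_set_pi Set.finite_univ fun _ _ => isOpen_Ioo).mem_nhds fun M _ => ⟨?_, ?_⟩
    · linarith [hcμ M]
    · linarith [hμC M]
  rw [← integral_entropyDeriv model p hμ]
  refine hasFDerivAt_integral_of_dominated_of_fderiv_le
    (F := fun μ x => Real.negMulLog (evidence model μ x)) (F' := entropyDeriv model)
    (bound := fun _ => ∑ _M : 𝓜, (max |Real.log (c / 2)| |Real.log (C + 1)| + 1)) hsμ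
    (Filter.Eventually.of_forall fun ν =>
      (Real.continuous_negMulLog.measurable.comp (measurable_evidence model ν)).aestronglyMeasurable)
    (integrable_negMulLog_evidence model p hμ)
    (aestronglyMeasurable_entropyDeriv model p hμ) ?_ (integrable_const _) ?_
  · filter_upwards [sum_likelihood_ae model p] with x hx ν hν
    exact norm_entropyDeriv_le model (half_pos hc) (fun M => (hν M trivial).1.le)
      (fun M => (hν M trivial).2.le) hx
  · filter_upwards [sum_likelihood_ae model p] with x hx ν hν
    exact hasFDerivAt_negMulLog_evidence model
      ((half_pos hc).trans_le (le_evidence model (fun M => (hν M trivial).1.le) hx)).ne'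

variable {model p} {f : 𝓜 → D → ℝ} {opt : 𝓜 → D} {η : ℝ} {ρ μ : 𝓜 → ℝ}

omit [Fintype 𝓜] [MeasurableSpace.CountableOrCountablyGenerated D O] in
lemma integrable_compProd_reward (hf : ∀ M, Integrable (f M) p) (M : 𝓜) :
    Integrable (fun x : D × O => f M (opt M) - f M x.1) (p ⊗ₘ model M) := by
  refine (integrable_const _).sub ?_
  have : Integrable (f M) ((p ⊗ₘ model M).map Prod.fst) := by
    have h := Measure.fst_compProd p (model M)
    rw [Measure.fst] at h
    rw [h]; exact hf M
  exact this.comp_measurable measurable_fst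

/-- The mixture of the models under `μ` has density `evidence model μ`, so the expected KL term is
the integral of `evidence_mul_finiteKL_posterior`. Only positivity of `μ` is needed, hence the
formula holds on an open set. -/
lemma mair_eq [Nonempty 𝓜] (hf : ∀ M, Integrable (f M) p) (hρ : ∀ M, 0 < ρ M)
    (hμ : ∀ M, 0 < μ M) :
    mair model f opt η ρ p μ =
      (∑ M, μ M * (∫ x, (f M (opt M) - f M x.1) ∂(p ⊗ₘ model M)
        - 1 / η * (Real.log (μ M) - Real.log (ρ M)
          + ∫ x, likelihood model M x * Real.log (likelihood model M x) ∂dominating model p)))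
      - 1 / η * ∫ x, Real.negMulLog (evidence model μ x) ∂dominating model p := by
  have hKL : ∀ M, Integrable (fun x => finiteKL (posterior model μ x) ρ) (p ⊗ₘ model M) :=
    fun M => Integrable.of_bound (measurable_finiteKL_posterior model μ ρ).aestronglyMeasurable _
      (Filter.Eventually.of_forall fun x =>
        abs_finiteKL_posterior_le model (fun M => (hμ M).le) hρ x)
  have key : ∑ M, μ M * ∫ x, finiteKL (posterior model μ x) ρ ∂(p ⊗ₘ model M) =
      (∑ M, μ M * (Real.log (μ M) - Real.log (ρ M)
          + ∫ x, likelihood model M x * Real.log (likelihood model M x) ∂dominating model p))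
      + ∫ x, Real.negMulLog (evidence model μ x) ∂dominating model p := by
    have i1 : ∀ M, Integrable (fun x => (μ M * (Real.log (μ M) - Real.log (ρ M)))
        * likelihood model M x + μ M * (likelihood model M x * Real.log (likelihood model M x)))
        (dominating model p) := fun M =>
      ((integrable_likelihood model p M).const_mul _).add
        ((integrable_likelihood_mul_log model p M).const_mul _)
    calc ∑ M, μ M * ∫ x, finiteKL (posterior model μ x) ρ ∂(p ⊗ₘ model M)
        = ∑ M, ∫ x, μ M * (likelihood model M x * finiteKL (posterior model μ x) ρ)
            ∂dominating model p := by
          refine Finset.sum_congr rfl fun M _ => ?_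
          rw [integral_compProd_model, integral_const_mul]
      _ = ∫ x, ∑ M, μ M * (likelihood model M x * finiteKL (posterior model μ x) ρ)
            ∂dominating model p := by
          rw [integral_finsetSum _ fun M _ => ?_]
          exact ((integrable_compProd_model_iff model p M _).1 (hKL M)).const_mul _
      _ = ∫ x, ((∑ M, ((μ M * (Real.log (μ M) - Real.log (ρ M))) * likelihood model M x
            + μ M * (likelihood model M x * Real.log (likelihood model M x))))
            + Real.negMulLog (evidence model μ x)) ∂dominating model p := by
          refine integral_congr_ae ?_
          filter_upwards [sum_likelihood_ae model p] with x hx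
          rw [← evidence_mul_finiteKL_posterior model hμ hρ hx, evidence, Finset.sum_mul]
          exact Finset.sum_congr rfl fun M _ => by ring
      _ = _ := by
          rw [integral_add (integrable_finsetSum _ fun M _ => i1 M)
            (integrable_negMulLog_evidence model p hμ), integral_finsetSum _ fun M _ => i1 M]
          congr 1
          refine Finset.sum_congr rfl fun M _ => ?_
          rw [integral_add ((integrable_likelihood model p M).const_mul _)
            ((integrable_likelihood_mul_log model p M).const_mul _), integral_const_mul,
            integral_const_mul, integral_likelihood]
          ring
  have hsplit : ∀ M, ∫ x, (f M (opt M) - f M x.1 - 1 / η * finiteKL (posterior model μ x) ρ)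
      ∂(p ⊗ₘ model M) = ∫ x, (f M (opt M) - f M x.1) ∂(p ⊗ₘ model M)
        - 1 / η * ∫ x, finiteKL (posterior model μ x) ρ ∂(p ⊗ₘ model M) := fun M => by
    rw [integral_sub (integrable_compProd_reward hf M) ((hKL M).const_mul _), integral_const_mul]
  simp_rw [mair, hsplit, mul_sub, mul_left_comm (μ _) (1 / η)]
  rw [Finset.sum_sub_distrib, Finset.sum_sub_distrib, ← Finset.mul_sum, ← Finset.mul_sum, key]
  ring

variable (model p f opt η ρ μ) in
/-- The partial derivatives of `mair` at a belief with positive entries. -/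
def mairPartial (M : 𝓜) : ℝ :=
  ∫ x, (f M (opt M) - f M x.1) ∂(p ⊗ₘ model M)
    - 1 / η * (Real.log (μ M) - Real.log (ρ M)
      + ∫ x, likelihood model M x * Real.log (likelihood model M x) ∂dominating model p
      - ∫ x, likelihood model M x * Real.log (evidence model μ x) ∂dominating model p)

/-- The constant `-1 / η` from differentiating `μ M * log (μ M)` cancels the `+1 / η` from the
entropy of the evidence, so no additive constant survives in `mairPartial`. -/
lemma hasFDerivAt_mair [Nonempty 𝓜] (hf : ∀ M, Integrable (f M) p) (hρ : ∀ M, 0 < ρ M)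
    (hμ : ∀ M, 0 < μ M) :
    HasFDerivAt (mair model f opt η ρ p)
      (∑ M, mairPartial model p f opt η ρ μ M
        • (ContinuousLinearMap.proj M : (𝓜 → ℝ) →L[ℝ] ℝ)) μ := by
  have hev : ∀ᶠ ν in nhds μ, ∀ M, 0 < ν M := by
    filter_upwards [(isOpen_set_pi Set.finite_univ fun (M : 𝓜) _ => isOpen_Ioi (a := (0 : ℝ))).mem_nhds
      (show μ ∈ _ from fun M _ => hμ M)] with ν hν M using hν M trivial
  refine HasFDerivAt.congr_of_eventuallyEq ?_ (hev.mono fun ν hν => mair_eq hf hρ hν)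
  have h1 : ∀ (M : 𝓜) (a r e : ℝ), HasFDerivAt
      (fun ν : 𝓜 → ℝ => ν M * (a - 1 / η * (Real.log (ν M) - r + e)))
      ((a - 1 / η * (Real.log (μ M) - r + e) - 1 / η)
        • (ContinuousLinearMap.proj M : (𝓜 → ℝ) →L[ℝ] ℝ)) μ := by
    intro M a r e
    have hd : HasDerivAt (fun t : ℝ => t * (a - 1 / η * (Real.log t - r + e)))
        (a - 1 / η * (Real.log (μ M) - r + e) - 1 / η) (μ M) := by
      have := (hasDerivAt_id (μ M)).mul (((((Real.hasDerivAt_log (hμ M).ne').sub_const r).add_const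
        e).const_mul (1 / η)).const_sub a)
      refine this.congr_deriv ?_
      have := (hμ M).ne'
      simp only [id]
      field_simp
      ring
    exact hd.comp_hasFDerivAt μ (hasFDerivAt_apply (𝕜 := ℝ) M μ)
  refine ((HasFDerivAt.fun_sum fun M _ => h1 M _ _ _).sub
    ((hasFDerivAt_integral_negMulLog_evidence model p hμ).const_mul (1 / η))).congr_fderiv ?_
  rw [Finset.smul_sum, ← Finset.sum_sub_distrib]
  refine Finset.sum_congr rfl fun M _ => ?_
  rw [smul_smul, ← sub_smul, mairPartial]
  congr 1
  ring

/-- Euler's identity for a function homogeneous of degree one. -/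
lemma mair_eq_sum_mairPartial [Nonempty 𝓜] (hf : ∀ M, Integrable (f M) p) (hρ : ∀ M, 0 < ρ M)
    (hμ : ∀ M, 0 < μ M) :
    mair model f opt η ρ p μ = ∑ M, mairPartial model p f opt η ρ μ M * μ M := by
  rw [mair_eq hf hρ hμ, integral_negMulLog_evidence model p hμ, mul_neg, sub_neg_eq_add,
    Finset.mul_sum, ← Finset.sum_add_distrib]
  exact Finset.sum_congr rfl fun M _ => by rw [mairPartial]; ring

lemma differentiableWithinAt_mair [Nonempty 𝓜] (hf : ∀ M, Integrable (f M) p)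
    (hρ : ∀ M, 0 < ρ M) (hμ : ∀ M, 0 < μ M) :
    DifferentiableWithinAt ℝ (mair model f opt η ρ p) (stdSimplex ℝ 𝓜) μ :=
  (hasFDerivAt_mair hf hρ hμ).differentiableAt.differentiableWithinAt

lemma mair_add_mairGradPairing [Nonempty 𝓜] [DecidableEq 𝓜] (hf : ∀ M, Integrable (f M) p)
    (hρ : ∀ M, 0 < ρ M) (hμ : ∀ M, 0 < μ M) (hμs : μ ∈ stdSimplex ℝ 𝓜) (M₀ : 𝓜) :
    mair model f opt η ρ p μ + mairGradPairing model f opt η ρ p μ M₀ =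
      mairPartial model p f opt η ρ μ M₀ := by
  -- The simplex has no interior in `𝓜 → ℝ`, so `fderivWithin` is just some derivative within it.
  -- All such derivatives agree on tangent directions, and the segment from `μ` to the vertex
  -- provides this one.
  have htan : Pi.single M₀ 1 - μ ∈ tangentConeAt ℝ (stdSimplex ℝ 𝓜) μ :=
    mem_tangentConeAt_of_segment_subset
      ((convex_stdSimplex ℝ 𝓜).segment_subset hμs (single_mem_stdSimplex ℝ M₀))
  have huniq := (differentiableWithinAt_mair (model := model) (opt := opt) (η := η)
    hf hρ hμ).hasFDerivWithinAt.unique_on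
    (hasFDerivAt_mair (model := model) (opt := opt) (η := η) hf hρ hμ).hasFDerivWithinAt htan
  rw [mairGradPairing, huniq, mair_eq_sum_mairPartial hf hρ hμ]
  simp [mul_sub, Finset.sum_sub_distrib, Pi.single_apply]

omit [∀ M, IsMarkovKernel (model M)] in
lemma log_posterior {μ : 𝓜 → ℝ} {M : 𝓜} (hM : 0 < μ M) {x : D × O}
    (hl : 0 < likelihood model M x) (hS : 0 < evidence model μ x) :
    Real.log (posterior model μ x M) =
      Real.log (μ M) + Real.log (likelihood model M x) - Real.log (evidence model μ x) := by
  rw [← Real.log_mul hM.ne' hl.ne', ← Real.log_div (mul_pos hM hl).ne' hS.ne']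
  rfl

lemma likelihood_mul_log_posterior_ae [Nonempty 𝓜] (hμ : ∀ M, 0 < μ M) (M : 𝓜) :
    (fun x => likelihood model M x * Real.log (posterior model μ x M))
      =ᵐ[dominating model p] fun x => Real.log (μ M) * likelihood model M x
        + likelihood model M x * Real.log (likelihood model M x)
        - likelihood model M x * Real.log (evidence model μ x) := by
  obtain ⟨c, C, hc, hcμ, -⟩ := exists_pos_bounds hμ
  filter_upwards [sum_likelihood_ae model p] with x hx
  rcases (likelihood_nonneg model M x).eq_or_lt with h | h
  · simp [← h]
  · rw [log_posterior (hμ M) h (hc.trans_le (le_evidence model hcμ hx))]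
    ring

lemma integrable_log_posterior [Nonempty 𝓜] (hμ : ∀ M, 0 < μ M) (M : 𝓜) :
    Integrable (fun x => Real.log (posterior model μ x M)) (p ⊗ₘ model M) := by
  rw [integrable_compProd_model_iff, integrable_congr (likelihood_mul_log_posterior_ae hμ M)]
  exact (((integrable_likelihood model p M).const_mul _).add
    (integrable_likelihood_mul_log model p M)).sub
    (integrable_likelihood_mul_log_evidence model p hμ M)

/-- The form that telescopes: the terms of `mairPartial` involving `μ` and the likelihoods assemble
into the log-posterior of `M`, averaged under `M` itself. -/
lemma mairPartial_eq [Nonempty 𝓜] (hμ : ∀ M, 0 < μ M) (M : 𝓜) :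
    mairPartial model p f opt η ρ μ M =
      ∫ x, (f M (opt M) - f M x.1) ∂(p ⊗ₘ model M)
      - 1 / η * (∫ x, Real.log (posterior model μ x M) ∂(p ⊗ₘ model M) - Real.log (ρ M)) := by
  rw [integral_compProd_model model p M fun x => Real.log (posterior model μ x M),
    integral_congr_ae (likelihood_mul_log_posterior_ae hμ M),
    integral_sub (((integrable_likelihood model p M).const_mul _).fun_add
      (integrable_likelihood_mul_log model p M))
      (integrable_likelihood_mul_log_evidence model p hμ M),
    integral_add ((integrable_likelihood model p M).const_mul _)
      (integrable_likelihood_mul_log model p M), integral_const_mul, integral_likelihood,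
    mairPartial]
  ring

end Gradient

/-! ### Disintegrating the law of the history -/

section History

variable {D O : Type*} [MeasurableSpace D] [MeasurableSpace O]

lemma measurable_snoc (t : ℕ) : Measurable
    (fun x : (Fin t → D × O) × (D × O) => (Fin.snoc x.1 x.2 : Fin (t + 1) → D × O)) := by
  refine measurable_pi_iff.2 fun i => ?_
  induction i using Fin.lastCases with
  | last => simpa using measurable_snd
  | cast i => simpa [Function.comp_def] using (measurable_pi_apply i).comp measurable_fst

omit [MeasurableSpace D] [MeasurableSpace O] in
lemma past_snoc_castSucc {n : ℕ} (h : Fin n → D × O) (x : D × O) (t : Fin n) :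
    past (Fin.snoc h x : Fin (n + 1) → D × O) t.castSucc = past h t := by
  funext i
  exact Fin.snoc_castSucc (α := fun _ => D × O) x h (Fin.castLE t.isLt.le i)

omit [MeasurableSpace D] [MeasurableSpace O] in
lemma past_snoc_last {n : ℕ} (h : Fin n → D × O) (x : D × O) :
    past (Fin.snoc h x : Fin (n + 1) → D × O) (Fin.last n) = h := by
  funext i
  exact Fin.snoc_castSucc (α := fun _ => D × O) x h i

variable (K : Kernel D O) [IsMarkovKernel K] (alg : (t : ℕ) → Kernel (Fin t → D × O) D)
  [∀ t, IsMarkovKernel (alg t)]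

lemma compProd_prodMkLeft_apply (t : ℕ) (h : Fin t → D × O) :
    (alg t ⊗ₖ Kernel.prodMkLeft (Fin t → D × O) K) h = alg t h ⊗ₘ K := by
  rw [Kernel.compProd_apply_eq_compProd_sectR]
  rfl

instance isProbabilityMeasure_historyLaw (t : ℕ) : IsProbabilityMeasure (historyLaw K alg t) := by
  induction t with
  | zero => rw [historyLaw]; infer_instance
  | succ t ih =>
    rw [historyLaw]
    exact Measure.isProbabilityMeasure_map (measurable_snoc t).aemeasurable

lemma ae_ae_of_ae_historyLaw_succ {t : ℕ} {P : (Fin (t + 1) → D × O) → Prop}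
    (hP : ∀ᵐ h ∂historyLaw K alg (t + 1), P h) :
    ∀ᵐ h ∂historyLaw K alg t, ∀ᵐ x ∂(alg t h ⊗ₘ K), P (Fin.snoc h x) := by
  rw [historyLaw] at hP
  filter_upwards [Measure.ae_ae_of_ae_compProd (ae_of_ae_map (measurable_snoc t).aemeasurable hP)]
    with h hh
  rwa [compProd_prodMkLeft_apply] at hh

omit [IsMarkovKernel K] [∀ t, IsMarkovKernel (alg t)] in
lemma integrable_comp_snoc {t : ℕ} {A : (Fin (t + 1) → D × O) → ℝ}
    (hA : Integrable A (historyLaw K alg (t + 1))) :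
    Integrable (fun x : (Fin t → D × O) × (D × O) => A (Fin.snoc x.1 x.2))
      (historyLaw K alg t ⊗ₘ (alg t ⊗ₖ Kernel.prodMkLeft (Fin t → D × O) K)) := by
  rw [historyLaw] at hA
  exact hA.comp_measurable (measurable_snoc t)

lemma ae_integrable_snoc {t : ℕ} {A : (Fin (t + 1) → D × O) → ℝ}
    (hA : Integrable A (historyLaw K alg (t + 1))) :
    ∀ᵐ h ∂historyLaw K alg t, Integrable (fun x => A (Fin.snoc h x)) (alg t h ⊗ₘ K) := by
  filter_upwards [(integrable_comp_snoc K alg hA).ae_of_compProd] with h hh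
  rwa [Kernel.prodMkLeft_apply, compProd_prodMkLeft_apply] at hh

lemma integrable_integral_snoc {t : ℕ} {A : (Fin (t + 1) → D × O) → ℝ}
    (hA : Integrable A (historyLaw K alg (t + 1))) :
    Integrable (fun h => ∫ x, A (Fin.snoc h x) ∂(alg t h ⊗ₘ K)) (historyLaw K alg t) := by
  have := (integrable_comp_snoc K alg hA).integral_compProd
  simpa only [Kernel.prodMkLeft_apply, compProd_prodMkLeft_apply, Kernel.const_apply] using this

lemma integral_historyLaw_succ {t : ℕ} {A : (Fin (t + 1) → D × O) → ℝ}
    (hA : Integrable A (historyLaw K alg (t + 1))) :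
    ∫ h, A h ∂historyLaw K alg (t + 1) =
      ∫ h, ∫ x, A (Fin.snoc h x) ∂(alg t h ⊗ₘ K) ∂historyLaw K alg t := by
  have h1 := Measure.integral_compProd (integrable_comp_snoc K alg hA)
  simp only [compProd_prodMkLeft_apply] at h1
  rw [← h1]
  rw [historyLaw] at hA ⊢
  exact integral_map (measurable_snoc t).aemeasurable hA.aestronglyMeasurable

lemma map_init_historyLaw (t : ℕ) :
    (historyLaw K alg (t + 1)).map (fun h => (Fin.init h : Fin t → D × O)) =
      historyLaw K alg t := by
  have hinit : Measurable (fun h : Fin (t + 1) → D × O => (Fin.init h : Fin t → D × O)) :=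
    measurable_pi_iff.2 fun i => measurable_pi_apply i.castSucc
  rw [historyLaw, Measure.map_map hinit (measurable_snoc t)]
  have : ((fun h : Fin (t + 1) → D × O => (Fin.init h : Fin t → D × O)) ∘
      fun x : (Fin t → D × O) × (D × O) => (Fin.snoc x.1 x.2 : Fin (t + 1) → D × O))
      = Prod.fst := by
    funext x
    simp
  rw [this]
  exact Measure.fst_compProd _ _

/-- If the reward of the decision of round `t` has a finite expectation, then it is integrable
under the law of the decision for almost every history of `t` rounds. -/
lemma ae_integrable_alg {T : ℕ} {g : D → ℝ} (hgm : Measurable g) (t : Fin T)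
    (hg : Integrable (fun h : Fin T → D × O => g (h t).1) (historyLaw K alg T)) :
    ∀ᵐ h ∂historyLaw K alg t, Integrable g (alg t h) := by
  induction T with
  | zero => exact t.elim0
  | succ n ih =>
    induction t using Fin.lastCases with
    | last =>
      have := ae_integrable_snoc K alg hg
      simp only [Fin.snoc_last] at this
      filter_upwards [this] with h hh
      have h1 : Integrable (fun a => ∫ _o : O, g a ∂(K a)) (alg n h) := hh.integral_compProd
      simpa using h1
    | cast i =>
      refine ih i ?_
      have hinit : Measurable (fun h : Fin (n + 1) → D × O => (Fin.init h : Fin n → D × O)) :=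
        measurable_pi_iff.2 fun i => measurable_pi_apply i.castSucc
      rw [← map_init_historyLaw K alg n]
      exact (integrable_map_measure (hgm.comp (measurable_pi_apply i).fst).aestronglyMeasurable
        hinit.aemeasurable).2 hg

/-- A supermartingale-type bound in which no joint measurability of the potential `W` and of its
drift `V` in the history is needed. -/
lemma integral_le_of_potential (W V : (t : ℕ) → (Fin t → D × O) → ℝ) (T : ℕ)
    (hW : ∀ t < T, ∀ᵐ h ∂historyLaw K alg t,
      Integrable (fun x => W (t + 1) (Fin.snoc h x)) (alg t h ⊗ₘ K) ∧
        ∫ x, W (t + 1) (Fin.snoc h x) ∂(alg t h ⊗ₘ K) = W t h + V t h)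
    (A : (Fin T → D × O) → ℝ) (hA : Integrable A (historyLaw K alg T))
    (hle : ∀ᵐ h ∂historyLaw K alg T, A h + ∑ t : Fin T, V t (past h t) ≤ W T h) :
    ∫ h, A h ∂historyLaw K alg T ≤ W 0 Fin.elim0 := by
  induction T with
  | zero =>
    obtain ⟨h, hh⟩ := hle.exists
    have hconst : ∀ h', A h' = A h := fun h' => congrArg A (Subsingleton.elim _ _)
    simp only [hconst, integral_const, probReal_univ, one_smul]
    simpa [Subsingleton.elim h Fin.elim0] using hh
  | succ n ih =>
    rw [integral_historyLaw_succ K alg hA]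
    -- The induction replaces `A` by its conditional expectation given the first `n` rounds. `W` is
    -- only ever integrated over a single round with the past fixed.
    refine ih (fun t ht => hW t (by omega)) _ (integrable_integral_snoc K alg hA) ?_
    filter_upwards [ae_integrable_snoc K alg hA, hW n (by omega),
      ae_ae_of_ae_historyLaw_succ K alg hle] with h hAh ⟨hWi, hWe⟩ hleh
    have hmono : ∫ x, A (Fin.snoc h x) ∂(alg n h ⊗ₘ K) ≤
        ∫ x, (W (n + 1) (Fin.snoc h x) - (∑ t : Fin n, V t (past h t) + V n h))
          ∂(alg n h ⊗ₘ K) := by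
      refine integral_mono_ae hAh (hWi.sub (integrable_const _)) ?_
      filter_upwards [hleh] with x hx
      rw [Fin.sum_univ_castSucc] at hx
      simp only [past_snoc_castSucc] at hx
      have h2 : V (Fin.last n) (past (Fin.snoc h x : Fin (n + 1) → D × O) (Fin.last n)) = V n h :=
        congrArg (V n) (past_snoc_last h x)
      rw [h2] at hx
      have h3 : ∑ t : Fin n, V t.castSucc (past h t) = ∑ t : Fin n, V t (past h t) := rfl
      rw [h3] at hx
      linarith
    rw [integral_sub hWi (integrable_const _), hWe, integral_const, probReal_univ, one_smul]
      at hmono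
    linarith

end History

/-! ### The potential and its drift -/

section RegretBound

variable {D O 𝓜 : Type*} [MeasurableSpace D] [MeasurableSpace O]
  [MeasurableSpace.CountableOrCountablyGenerated D O] [Fintype 𝓜]
  (model : 𝓜 → Kernel D O)

lemma reference_succ_snoc (μ : (t : ℕ) → (Fin t → D × O) → 𝓜 → ℝ) (t : ℕ)
    (h : Fin t → D × O) (x : D × O) :
    reference model μ (t + 1) (Fin.snoc h x) = posterior model (μ t h) x := by
  rw [reference, Fin.init_snoc, Fin.snoc_last]

lemma reference_mem_Icc [Nonempty 𝓜] {μ : (t : ℕ) → (Fin t → D × O) → 𝓜 → ℝ} {T : ℕ}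
    (hμ : ∀ t < T, ∀ h M, 0 ≤ μ t h M) (h : Fin T → D × O) (M : 𝓜) :
    reference model μ T h M ∈ Set.Icc 0 1 := by
  cases T with
  | zero =>
    rw [reference]
    exact ⟨by positivity, by
      rw [one_div]; exact Nat.cast_inv_le_one _⟩
  | succ n =>
    rw [reference]
    exact ⟨posterior_nonneg model (hμ n n.lt_succ_self _) _ _,
      posterior_le_one model (hμ n n.lt_succ_self _) _ _⟩

/-- The accumulated regret of a history of `t` rounds plus the (scaled) log-loss of the reference
distribution at the true model. -/
def potential (f : 𝓜 → D → ℝ) (opt : 𝓜 → D) (η : ℝ)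
    (μ : (t : ℕ) → (Fin t → D × O) → 𝓜 → ℝ) (M : 𝓜) (t : ℕ) (h : Fin t → D × O) : ℝ :=
  ∑ s : Fin t, (f M (opt M) - f M (h s).1) - 1 / η * Real.log (reference model μ t h M)

variable {model} [∀ M, IsMarkovKernel (model M)] {f : 𝓜 → D → ℝ} {opt : 𝓜 → D} {η : ℝ}

omit [∀ M, IsMarkovKernel (model M)] in
lemma potential_succ_snoc (μ : (t : ℕ) → (Fin t → D × O) → 𝓜 → ℝ) (M : 𝓜) (t : ℕ)
    (h : Fin t → D × O) (x : D × O) :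
    potential model f opt η μ M (t + 1) (Fin.snoc h x) =
      ∑ s : Fin t, (f M (opt M) - f M (h s).1) + (f M (opt M) - f M x.1)
        - 1 / η * Real.log (posterior model (μ t h) x M) := by
  rw [potential, reference_succ_snoc, Fin.sum_univ_castSucc]
  simp only [Fin.snoc_castSucc, Fin.snoc_last]

/-- The next reference is the posterior, so one round adds the instantaneous regret and exchanges
`log ρ` for the log-posterior; by `mairPartial_eq` the mean change is `mairPartial`. -/
lemma potential_step [Nonempty 𝓜] {μ : (t : ℕ) → (Fin t → D × O) → 𝓜 → ℝ} {t : ℕ}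
    {h : Fin t → D × O} {p : Measure D} [IsProbabilityMeasure p]
    (hf : ∀ M, Integrable (f M) p) (hμ : ∀ M, 0 < μ t h M) (M : 𝓜) :
    Integrable (fun x => potential model f opt η μ M (t + 1) (Fin.snoc h x)) (p ⊗ₘ model M) ∧
      ∫ x, potential model f opt η μ M (t + 1) (Fin.snoc h x) ∂(p ⊗ₘ model M) =
        potential model f opt η μ M t h
          + mairPartial model p f opt η (reference model μ t h) (μ t h) M := by
  have h1 := (integrable_const (μ := p ⊗ₘ model M)
    (∑ s : Fin t, (f M (opt M) - f M (h s).1))).fun_add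
    (integrable_compProd_reward (model := model) (opt := opt) hf M)
  have h2 := (integrable_log_posterior (model := model) (p := p) hμ M).const_mul (1 / η)
  simp_rw [potential_succ_snoc]
  refine ⟨h1.sub h2, ?_⟩
  rw [integral_sub h1 h2, integral_add (integrable_const _)
    (integrable_compProd_reward (model := model) (opt := opt) hf M), integral_const,
    integral_const_mul, probReal_univ, one_smul, mairPartial_eq hμ, potential]
  ring

end RegretBound

end DMSO

end

theorem theorem7p1 {D O 𝓜 : Type*} [MeasurableSpace D] [MeasurableSpace O]
    [MeasurableSpace.CountableOrCountablyGenerated D O] [Fintype 𝓜] [DecidableEq 𝓜]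
    (model : 𝓜 → Kernel D O) [∀ M, IsMarkovKernel (model M)]
    (f : 𝓜 → D → ℝ) (hfm : ∀ M, Measurable (f M)) (opt : 𝓜 → D)
    (hopt : ∀ M a, f M a ≤ f M (opt M))
    (Mstar : 𝓜) (η : ℝ) (hη : 0 < η) (T : ℕ)
    (alg : (t : ℕ) → Kernel (Fin t → D × O) D) [∀ t, IsMarkovKernel (alg t)]
    -- the mean rewards of the decisions taken have finite expectations
    (hf : ∀ M, ∀ t : Fin T, Integrable (fun h : Fin T → D × O => f M (h t).1)
      (DMSO.historyLaw (model Mstar) alg T))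
    (μ : (t : ℕ) → (Fin t → D × O) → 𝓜 → ℝ)
    (hμ : ∀ t < T, ∀ h, μ t h ∈ stdSimplex ℝ 𝓜)
    -- beliefs and reference distributions lie in the interior of the simplex
    (hμpos : ∀ t < T, ∀ᵐ h ∂DMSO.historyLaw (model Mstar) alg t, ∀ M, 0 < μ t h M)
    (hρpos : ∀ t < T, ∀ᵐ h ∂DMSO.historyLaw (model Mstar) alg t,
      ∀ M, 0 < DMSO.reference model μ t h M) :
    -- the gradient of MAIR exists in every round
    (∀ t < T, ∀ᵐ h ∂DMSO.historyLaw (model Mstar) alg t,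
      DifferentiableWithinAt ℝ
        (DMSO.mair model f opt η (DMSO.reference model μ t h) (alg t h))
        (stdSimplex ℝ 𝓜) (μ t h)) ∧
    -- the regret bound, whenever the expectation on its right-hand side exists
    (Integrable (fun h : Fin T → D × O => ∑ t : Fin T,
        (DMSO.mair model f opt η (DMSO.reference model μ t (DMSO.past h t))
            (alg t (DMSO.past h t)) (μ t (DMSO.past h t))
          + DMSO.mairGradPairing model f opt η (DMSO.reference model μ t (DMSO.past h t))
            (alg t (DMSO.past h t)) (μ t (DMSO.past h t)) Mstar))
        (DMSO.historyLaw (model Mstar) alg T) →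
      DMSO.regret (model Mstar) (f Mstar) alg T ≤
        Real.log (Fintype.card 𝓜) / η +
          ∫ h, ∑ t : Fin T,
            (DMSO.mair model f opt η (DMSO.reference model μ t (DMSO.past h t))
                (alg t (DMSO.past h t)) (μ t (DMSO.past h t))
              + DMSO.mairGradPairing model f opt η (DMSO.reference model μ t (DMSO.past h t))
                (alg t (DMSO.past h t)) (μ t (DMSO.past h t)) Mstar)
          ∂DMSO.historyLaw (model Mstar) alg T) := by
  have : Nonempty 𝓜 := ⟨Mstar⟩
  have : Nonempty D := ⟨opt Mstar⟩
  -- Rewards depend on the decision alone, so integrability along the true history yields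
  -- integrability under `alg t h` for every model, including the false ones.
  have hreg : ∀ t < T, ∀ᵐ h ∂DMSO.historyLaw (model Mstar) alg t,
      ∀ M, Integrable (f M) (alg t h) := fun t ht =>
    ae_all_iff.2 fun M => DMSO.ae_integrable_alg (model Mstar) alg (hfm M) ⟨t, ht⟩ (hf M ⟨t, ht⟩)
  refine ⟨fun t ht => ?_, fun hR => ?_⟩
  · filter_upwards [hreg t ht, hμpos t ht, hρpos t ht] with h h1 h2 h3
    exact DMSO.differentiableWithinAt_mair h1 h3 h2
  set R : (t : ℕ) → (Fin t → D × O) → ℝ := fun t h =>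
    DMSO.mair model f opt η (DMSO.reference model μ t h) (alg t h) (μ t h)
      + DMSO.mairGradPairing model f opt η (DMSO.reference model μ t h) (alg t h) (μ t h) Mstar
    with hRdef
  have hG : Integrable (fun h : Fin T → D × O =>
      ∑ t : Fin T, (f Mstar (opt Mstar) - f Mstar (h t).1))
      (DMSO.historyLaw (model Mstar) alg T) :=
    integrable_finsetSum _ fun t _ => (integrable_const _).sub (hf Mstar t)
  have hW : ∀ t < T, ∀ᵐ h ∂DMSO.historyLaw (model Mstar) alg t,
      Integrable (fun x => DMSO.potential model f opt η μ Mstar (t + 1) (Fin.snoc h x))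
          (alg t h ⊗ₘ model Mstar) ∧
        ∫ x, DMSO.potential model f opt η μ Mstar (t + 1) (Fin.snoc h x)
          ∂(alg t h ⊗ₘ model Mstar) = DMSO.potential model f opt η μ Mstar t h + R t h := by
    intro t ht
    filter_upwards [hreg t ht, hμpos t ht, hρpos t ht] with h h1 h2 h3
    have hRt : R t h = DMSO.mairPartial model (alg t h) f opt η
        (DMSO.reference model μ t h) (μ t h) Mstar :=
      DMSO.mair_add_mairGradPairing h1 h3 h2 (hμ t ht h) Mstar
    rw [hRt]
    exact DMSO.potential_step h1 h2 Mstar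
  have hμ0 : ∀ t < T, ∀ h M, 0 ≤ μ t h M := fun t ht h M => (hμ t ht h).1 M
  have key := DMSO.integral_le_of_potential (model Mstar) alg
    (DMSO.potential model f opt η μ Mstar) R T hW _ (hG.sub hR)
    (Filter.Eventually.of_forall fun h => by
      -- The reference after the last round is not assumed positive; membership in `[0, 1]` is
      -- enough, as `Real.log 0 = 0`.
      have hρ := DMSO.reference_mem_Icc model hμ0 h Mstar
      have hlog : 1 / η * Real.log (DMSO.reference model μ T h Mstar) ≤ 0 :=
        mul_nonpos_of_nonneg_of_nonpos (by positivity) (Real.log_nonpos hρ.1 hρ.2)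
      simp only [Pi.sub_apply, DMSO.potential, hRdef]
      linarith)
  have h0 : DMSO.potential model f opt η μ Mstar 0 Fin.elim0
      = Real.log (Fintype.card 𝓜) / η := by
    simp only [DMSO.potential, DMSO.reference, Finset.univ_eq_empty, Finset.sum_empty, one_div,
      Real.log_inv]
    ring
  rw [integral_sub' hG hR, h0, sub_le_iff_le_add] at key
  -- Each fixed comparator `a` is dominated pointwise by `opt Mstar`, the comparator used in the
  -- potential.
  refine ciSup_le fun a => le_trans (integral_mono ?_ hG fun h => ?_) key
  · exact (integrable_const _).sub (integrable_finsetSum _ fun t _ => hf Mstar t)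
  · simp only [Finset.sum_sub_distrib]
    exact sub_le_sub_right (Finset.sum_le_sum fun t _ => hopt Mstar a) _
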